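/- Let $\mathbb{P} \subseteq \mathbb{Z}$ be the set of (positive) prime numbers. For $S \subseteq \mathbb{R}^d$, the Helly number $h(S)$ is the least $k \in \{0,1,2,\dots\}$ such that in every finite family of convex sets in $\mathbb{R}^d$, if the intersection of every subfamily of at most $k$ sets contains a point of $S$, then the intersection of the entire family contains a point of $S$; if no such $k$ exists, $h(S) = \infty$. (The intersection of the empty family is $\mathbb{R}^d$.) Then, regarding $\mathbb{Z}^2$ as a subset of $\mathbb{R}^2$, both $h\big((\mathbb{Z}\setminus\mathbb{P})^2\big)$ and $h(\mathbb{Z}^2\setminus\mathbb{P}^2)$ are finite; moreover, $h\big((\mathbb{Z}\setminus\mathbb{P})^2\big) \le 24$ and $h(\mathbb{Z}^2\setminus\mathbb{P}^2) \le 24$. -/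

import Mathlib

/-- `HellyProperty S k`: in any finite family of convex sets of `ℝᵈ`, if the intersection of every
subfamily of at most `k` sets contains a point of `S`, then the intersection of the entire family
contains a point of `S`. (The intersection of the empty subfamily is all of `ℝᵈ`.) -/
def HellyProperty {d : ℕ} (S : Set (EuclideanSpace ℝ (Fin d))) (k : ℕ) : Prop :=
  ∀ (n : ℕ) (F : Fin n → Set (EuclideanSpace ℝ (Fin d))), (∀ i, Convex ℝ (F i)) →
    (∀ I : Finset (Fin n), I.card ≤ k → ((⋂ i ∈ I, F i) ∩ S).Nonempty) →
      ((⋂ i, F i) ∩ S).Nonempty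

/-- The Helly number of `S`: the least `k` with the Helly property, and `⊤` if there is none. -/
noncomputable def hellyNumber {d : ℕ} (S : Set (EuclideanSpace ℝ (Fin d))) : ℕ∞ :=
  ⨅ (k : ℕ) (_ : HellyProperty S k), (k : ℕ∞)

/-- The set of (positive) prime numbers, as a set of integers. -/
def intPrimes : Set ℤ := {z | ∃ p : ℕ, p.Prime ∧ z = p}

/-- A set of pairs of integers, viewed as a set of points of the plane `ℝ²`. -/
def planePoints (A : Set (ℤ × ℤ)) : Set (EuclideanSpace ℝ (Fin 2)) :=
  (fun z : ℤ × ℤ => !₂[(z.1 : ℝ), (z.2 : ℝ)]) '' A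

/-! For a discrete set, the Helly number is bounded by the number of vertices of a hollow polygon:
one with vertices in the set and no further point of the set in its hull
(`HellyProperty.of_card_hollow_le`). Hollowness passes to subsets of the vertices (`IsHollow.mono`),
so vertices can be sorted into regions and counted region by region.

About primes, only this matters: 2 is prime, no integer up to 1 is, and no even integer from 3 on
is. Hence in each region either all lattice points, or those with a prescribed coordinate even, or
those with both even, lie in the set. Vertices in such a sublattice number at most four: two of them
congruent modulo its double would have their midpoint in the set
(`IsHollow.card_le_four_of_midpoint`).

The remaining vertices span a polygon that avoids the sublattice. Replacing an end of an edge by its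
midpoint halves the area of a triangle, so a class of points where this can always be repeated
contains only degenerate triangles (`latticeDet_eq_zero_of_descent`). This leaves at most two
vertices if a fixed coordinate is always odd, and at most four if no point of the hull has both
coordinates even (`IsHollow.card_le_four_of_parity_ne_zero`). -/

/-! ### From Helly numbers to hollow polytopes -/

/-- Anti-exchange property of the convex hull. -/
theorem convexHull_antiexchange {E : Type*} [AddCommGroup E] [Module ℝ E] {A : Set E} {x y : E}
    (hx : x ∉ convexHull ℝ A) (hxy : x ∈ convexHull ℝ (insert y A))
    (hyx : y ∈ convexHull ℝ (insert x A)) : x = y := by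
  rcases A.eq_empty_or_nonempty with rfl | hA
  · simpa using hxy
  rw [convexHull_insert hA, mem_convexJoin] at hxy hyx
  simp only [Set.mem_singleton_iff, exists_eq_left] at hxy hyx
  obtain ⟨a, ha, α, α', hα, hα', hs, rfl⟩ := hxy
  obtain ⟨b, hb, β, β', hβ, hβ', hs', hy⟩ := hyx
  by_contra hne
  apply hx
  have hα1 : α < 1 := by
    rcases lt_or_eq_of_le (show α ≤ 1 by linarith) with h | h
    · exact h
    · subst h
      obtain rfl : α' = 0 := by linarith
      simp at hne
  have hβ1 : β ≤ 1 := by linarith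
  have hpos : 0 < 1 - α * β := by nlinarith
  -- Substituting `y = β x + β' b` into `x = α y + α' a` and solving for `x` gives these weights on
  -- `b` and `a`.
  have hc := convex_convexHull ℝ A hb ha (a := α * β' / (1 - α * β)) (b := α' / (1 - α * β))
    (by positivity) (by positivity) (by
      rw [← add_div, div_eq_one_iff_eq hpos.ne']
      have : β' = 1 - β := by linarith
      have : α' = 1 - α := by linarith
      subst_vars; ring)
  convert hc using 1
  have key : (1 - α * β) • (α • y + α' • a) = (α * β') • b + α' • a := by
    have h1 : α • y = (α * β) • (α • y + α' • a) + (α * β') • b := by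
      conv_lhs => rw [← hy]
      module
    rw [sub_smul, one_smul]
    nth_rewrite 1 [h1]
    abel
  rw [div_eq_inv_mul, div_eq_inv_mul, mul_smul, mul_smul _ α', ← smul_add, ← key, smul_smul,
    inv_mul_cancel₀ hpos.ne', one_smul]

/-- A family of relatively convex subsets of `T` without common point, any member of which may be
dropped to obtain a common point. -/
structure IsCriticalFamily {E ι : Type*} [AddCommGroup E] [Module ℝ E] (T : Set E)
    (A : ι → Set E) : Prop where
  subset : ∀ i, A i ⊆ T
  convex : ∀ i, convexHull ℝ (A i) ∩ T ⊆ A i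
  no_common : ¬ ∃ x ∈ T, ∀ i, x ∈ A i
  common_of_drop : ∀ i, ∃ x ∈ T, ∀ j, j ≠ i → x ∈ A j

/-- Enlarge the family to a maximal critical one, and for each `i` take a common point of the other
members that is as close to `A i` as possible. Maximality leaves no room in `T` between `A i` and `x
i`, and every other `x j` lies in `A i`. -/
theorem IsCriticalFamily.exists_hollow {E ι : Type*} [AddCommGroup E] [Module ℝ E] [Finite ι]
    {T : Set E} (hT : T.Finite) {A₀ : ι → Set E} (hA₀ : IsCriticalFamily T A₀) :
    ∃ x : ι → E, Function.Injective x ∧ (∀ i, x i ∈ T) ∧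
      (∀ i, x i ∉ convexHull ℝ (Set.range x \ {x i})) ∧
      convexHull ℝ (Set.range x) ∩ T ⊆ Set.range x := by
  classical
  have hfin : {A : ι → Set E | IsCriticalFamily T A}.Finite := by
    refine (Set.Finite.pi' (t := fun _ : ι => 𝒫 T) fun _ => hT.finite_subsets).subset ?_
    intro A hA i
    exact hA.subset i
  obtain ⟨A, -, hA⟩ := hfin.exists_le_maximal hA₀
  have hAc : IsCriticalFamily T A := hA.prop
  -- Minimality only says that the two hulls have the same trace on `T`; anti-exchange turns this
  -- into equality of the points.
  have hmin : ∀ i, ∃ x, (x ∈ T ∧ ∀ j, j ≠ i → x ∈ A j) ∧ ∀ y, (y ∈ T ∧ ∀ j, j ≠ i → y ∈ A j) →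
      y ∈ convexHull ℝ (insert x (A i)) → y = x := by
    intro i
    have hX : {x | x ∈ T ∧ ∀ j, j ≠ i → x ∈ A j}.Finite := hT.subset fun x hx => And.left hx
    obtain ⟨x, hx⟩ := hX.exists_minimalFor (fun x => convexHull ℝ (insert x (A i)) ∩ T)
      _ (hAc.common_of_drop i)
    refine ⟨x, hx.1, fun y hy hyx => ?_⟩
    have h1 : convexHull ℝ (insert y (A i)) ⊆ convexHull ℝ (insert x (A i)) :=
      convexHull_min (Set.insert_subset hyx
        ((Set.subset_insert _ _).trans (subset_convexHull ℝ _))) (convex_convexHull ℝ _)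
    have h2 := hx.2 hy (Set.inter_subset_inter_left _ h1)
    have h3 : x ∈ convexHull ℝ (insert y (A i)) :=
      (h2 ⟨subset_convexHull ℝ _ (Set.mem_insert _ _), hx.1.1⟩).1
    refine convexHull_antiexchange (fun h => hAc.no_common ⟨y, hy.1, fun j => ?_⟩) hyx h3
    by_cases hj : j = i
    · subst hj; exact hAc.convex _ ⟨h, hy.1⟩
    · exact hy.2 j hj
  choose x hxT hx using hmin
  have hxi : ∀ i, x i ∉ A i := fun i h => hAc.no_common ⟨x i, (hxT i).1, fun j => by
    by_cases hj : j = i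
    · subst hj; exact h
    · exact (hxT i).2 j hj⟩
  -- Adding `t` to `A i` destroys criticality, so a common point `y` appears. It lies in the hull of
  -- `A i` and `x i`, so `y = x i` by the choice of `x i`; anti-exchange then identifies `t` with `x
  -- i`.
  have hkey : ∀ i, ∀ t ∈ T, t ∉ A i → t ∈ convexHull ℝ (insert (x i) (A i)) → t = x i := by
    intro i t ht hti htx
    let B : ι → Set E := Function.update A i (convexHull ℝ (insert t (A i)) ∩ T)
    have hAi : A i ⊆ convexHull ℝ (insert t (A i)) ∩ T := fun a ha =>
      ⟨subset_convexHull ℝ _ (Set.mem_insert_of_mem _ ha), hAc.subset i ha⟩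
    have hAB : A ≤ B := by
      intro j
      by_cases hj : j = i
      · subst hj; simpa [B] using hAi
      · simp [B, hj]
    have htB : t ∈ B i := by
      simp only [B, Function.update_self]
      exact ⟨subset_convexHull ℝ _ (Set.mem_insert _ _), ht⟩
    have hB : ¬ IsCriticalFamily T B := fun h => hti (hA.2 h hAB i htB)
    have hcommon : ∃ y ∈ T, ∀ j, y ∈ B j := by
      by_contra hno
      refine hB ⟨fun j => ?_, fun j => ?_, hno, fun j => ?_⟩
      · by_cases hj : j = i
        · subst hj; simp [B]
        · simpa [B, hj] using hAc.subset j
      · by_cases hj : j = i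
        · subst hj
          simp only [B, Function.update_self]
          exact Set.inter_subset_inter_left _
            (convexHull_min Set.inter_subset_left (convex_convexHull ℝ _))
        · simpa [B, hj] using hAc.convex j
      · obtain ⟨z, hz, h⟩ := hAc.common_of_drop j
        exact ⟨z, hz, fun l hl => hAB l (h l hl)⟩
    obtain ⟨y, hyT, hy⟩ := hcommon
    have hyi : y ∈ convexHull ℝ (insert t (A i)) := by
      have := hy i
      simp only [B, Function.update_self] at this
      exact this.1
    have hyj : ∀ j, j ≠ i → y ∈ A j := fun j hj => by simpa [B, hj] using hy j
    have hsub : convexHull ℝ (insert t (A i)) ⊆ convexHull ℝ (insert (x i) (A i)) :=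
      convexHull_min (Set.insert_subset htx
        ((Set.subset_insert _ _).trans (subset_convexHull ℝ _))) (convex_convexHull ℝ _)
    obtain rfl := hx i y ⟨hyT, hyj⟩ (hsub hyi)
    exact convexHull_antiexchange (fun h => hti (hAc.convex i ⟨h, ht⟩)) htx hyi
  have hrange : ∀ i, Set.range x \ {x i} ⊆ A i := by
    rintro i _ ⟨⟨j, rfl⟩, hj⟩
    exact (hxT j).2 i fun h => hj (by rw [h]; rfl)
  refine ⟨x, fun i j hij => ?_, fun i => (hxT i).1, fun i h => ?_, ?_⟩
  · by_contra hne
    exact hxi j (hij ▸ (hxT i).2 j (Ne.symm hne))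
  · exact hxi i (hAc.convex i ⟨convexHull_mono (hrange i) h, (hxT i).1⟩)
  · rintro t ⟨ht, htT⟩
    obtain ⟨i, hi⟩ : ∃ i, t ∉ A i := by
      by_contra! h
      exact hAc.no_common ⟨t, htT, h⟩
    refine ⟨i, (hkey i t htT hi (convexHull_mono ?_ ht)).symm⟩
    intro z hz
    by_cases hzi : z = x i
    · exact Or.inl hzi
    · exact Or.inr (hrange i ⟨hz, hzi⟩)

/-- A discrete set has the Helly property for `k` if every finite subset in convex position, whose
convex hull contains no further point of the set, has at most `k` points. -/
theorem HellyProperty.of_card_hollow_le {d : ℕ} {S : Set (EuclideanSpace ℝ (Fin d))} {k : ℕ}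
    (hS : ∀ X : Set (EuclideanSpace ℝ (Fin d)), X.Finite → (convexHull ℝ X ∩ S).Finite)
    (h : ∀ V : Finset (EuclideanSpace ℝ (Fin d)), (V : Set _) ⊆ S →
      (∀ v ∈ V, v ∉ convexHull ℝ ((V : Set _) \ {v})) →
      convexHull ℝ (V : Set _) ∩ S ⊆ V → V.card ≤ k) : HellyProperty S k := by
  classical
  intro n F hF hI
  by_contra hne
  -- A minimal subfamily without a common point of `S` has more than `k` members; cut down to a
  -- finite part of `S`, it is critical and yields a hollow set of the same size.
  have hne' : ¬ ((⋂ i ∈ (Finset.univ : Finset (Fin n)), F i) ∩ S).Nonempty := by simpa using hne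
  obtain ⟨I, -, hImin⟩ := (Set.toFinite
    {I : Finset (Fin n) | ¬ ((⋂ i ∈ I, F i) ∩ S).Nonempty}).exists_le_minimal hne'
  have hcard : k < I.card := by
    by_contra hk
    exact hImin.prop (hI I (not_lt.mp hk))
  have hy : ∀ i : I, ∃ y ∈ S, ∀ j : I, j ≠ i → y ∈ F j := by
    intro i
    have hlt : I.erase i < I := Finset.erase_ssubset i.2
    have := hImin.not_prop_of_lt hlt
    simp only [Set.mem_ofPred_eq, not_not] at this
    obtain ⟨y, hy, hyS⟩ := this
    refine ⟨y, hyS, fun j hj => ?_⟩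
    simp only [Set.mem_iInter] at hy
    exact hy j (Finset.mem_erase.mpr ⟨fun e => hj (Subtype.ext e), j.2⟩)
  choose y hyS hyF using hy
  let T := convexHull ℝ (Set.range y) ∩ S
  have hT : T.Finite := hS _ (Set.finite_range y)
  have hyT : ∀ i, y i ∈ T := fun i => ⟨subset_convexHull ℝ _ ⟨i, rfl⟩, hyS i⟩
  have hA : IsCriticalFamily T (fun i : I => F i ∩ T) := by
    refine ⟨fun i => Set.inter_subset_right, fun i z hz => ⟨?_, hz.2⟩, ?_, fun i => ?_⟩
    · exact convexHull_min Set.inter_subset_left (hF i) hz.1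
    · rintro ⟨z, hz, hzF⟩
      refine hImin.prop ⟨z, ?_, hz.2⟩
      simp only [Set.mem_iInter]
      exact fun i hi => (hzF ⟨i, hi⟩).1
    · exact ⟨y i, hyT i, fun j hj => ⟨hyF i j hj, hyT i⟩⟩
  obtain ⟨x, hinj, hxT, hxc, hxe⟩ := hA.exists_hollow hT
  have hV : ((Finset.univ.image x : Finset _) : Set (EuclideanSpace ℝ (Fin d))) = Set.range x := by
    simp
  have hle := h (Finset.univ.image x) ?_ ?_ ?_
  · rw [Finset.card_image_of_injective _ hinj] at hle
    simp at hle
    omega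
  · rw [hV]
    rintro _ ⟨i, rfl⟩
    exact (hxT i).2
  · rw [hV]
    intro v hv
    obtain ⟨i, -, rfl⟩ := Finset.mem_image.mp hv
    exact hxc i
  · rw [hV]
    rintro t ⟨ht, htS⟩
    refine hxe ⟨ht, convexHull_min ?_ (convex_convexHull ℝ _) ht, htS⟩
    rintro _ ⟨i, rfl⟩
    exact (hxT i).1

/-! ### Parity and descent in the integer lattice -/

/-- Twice the signed area of a lattice triangle. -/
def latticeDet (a b c : ℤ × ℤ) : ℤ :=
  (b.1 - a.1) * (c.2 - a.2) - (b.2 - a.2) * (c.1 - a.1)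

theorem latticeDet_eq_zero_of_line {a b x y z : ℤ × ℤ} (hab : a ≠ b) (hx : latticeDet a b x = 0)
    (hy : latticeDet a b y = 0) (hz : latticeDet a b z = 0) : latticeDet x y z = 0 := by
  obtain ⟨a1, a2⟩ := a
  obtain ⟨b1, b2⟩ := b
  obtain ⟨x1, x2⟩ := x
  obtain ⟨y1, y2⟩ := y
  obtain ⟨z1, z2⟩ := z
  simp only [latticeDet, ne_eq, Prod.mk.injEq, not_and_or] at *
  rcases hab with h | h
  · have h' : b1 - a1 ≠ 0 := fun e => h (by omega)
    apply mul_left_cancel₀ h'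
    linear_combination (z1 - y1) * hx + (x1 - z1) * hy + (y1 - x1) * hz
  · have h' : b2 - a2 ≠ 0 := fun e => h (by omega)
    apply mul_left_cancel₀ h'
    linear_combination (z2 - y2) * hx + (x2 - z2) * hy + (y2 - x2) * hz

theorem latticeDet_self_left (a b : ℤ × ℤ) : latticeDet a b a = 0 := by
  simp [latticeDet]

theorem latticeDet_self_right (a b : ℤ × ℤ) : latticeDet a b b = 0 := by
  simp only [latticeDet]; ring

theorem latticeDet_rotate (a b c : ℤ × ℤ) : latticeDet b c a = latticeDet a b c := by
  simp only [latticeDet]; ring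

/-- The parity class of a lattice point. -/
def parity (z : ℤ × ℤ) : ZMod 2 × ZMod 2 := ((z.1 : ZMod 2), (z.2 : ZMod 2))

theorem exists_midpoint {u v : ℤ × ℤ} (h : parity u = parity v) : ∃ m : ℤ × ℤ, u + v = m + m := by
  obtain ⟨u1, u2⟩ := u
  obtain ⟨v1, v2⟩ := v
  simp only [parity, Prod.mk.injEq, ZMod.intCast_eq_intCast_iff, Int.ModEq] at h
  refine ⟨((u1 + v1) / 2, (u2 + v2) / 2), ?_⟩
  simp only [Prod.mk_add_mk, Prod.mk.injEq]
  constructor <;> omega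

set_option synthInstance.maxSize 1000 in
set_option synthInstance.maxHeartbeats 100000 in
theorem eq_or_eq_or_eq_of_add_add_eq : ∀ {p x y z : ZMod 2 × ZMod 2}, p ≠ 0 → x ≠ 0 → y ≠ 0 →
    z ≠ 0 → x + y + z = p → x = p ∨ y = p ∨ z = p := by decide

set_option synthInstance.maxSize 1000 in
set_option synthInstance.maxHeartbeats 100000 in
theorem eq_or_eq_or_eq_of_ne_zero : ∀ {x a b c : ZMod 2 × ZMod 2}, x ≠ 0 → a ≠ 0 → b ≠ 0 →
    c ≠ 0 → a ≠ b → c ≠ a → c ≠ b → x = a ∨ x = b ∨ x = c := by decide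

/-- A set of lattice points containing every lattice midpoint of two of its points. -/
def MidClosed (T : Set (ℤ × ℤ)) : Prop :=
  ∀ u ∈ T, ∀ v ∈ T, ∀ m, u + v = m + m → m ∈ T

theorem latticeDet_midpoint {u v m c : ℤ × ℤ} (h : u + v = m + m) :
    2 * latticeDet u m c = latticeDet u v c := by
  obtain ⟨u1, u2⟩ := u
  obtain ⟨v1, v2⟩ := v
  obtain ⟨m1, m2⟩ := m
  simp only [Prod.mk_add_mk, Prod.mk.injEq] at h
  obtain ⟨h1, h2⟩ := h
  obtain rfl : v1 = m1 + m1 - u1 := by omega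
  obtain rfl : v2 = m2 + m2 - u2 := by omega
  simp only [latticeDet]
  ring

/-- Descent: if in every triple from a class of triangles some edge can be halved within the class,
all triangles of the class are degenerate. -/
theorem latticeDet_eq_zero_of_descent {P : ℤ × ℤ → Prop}
    (h : ∀ a b c, P a → P b → P c → ∃ m, P m ∧
      (a + b = m + m ∨ b + c = m + m ∨ c + a = m + m)) {a b c : ℤ × ℤ}
    (ha : P a) (hb : P b) (hc : P c) : latticeDet a b c = 0 := by
  induction hn : (latticeDet a b c).natAbs using Nat.strong_induction_on generalizing a b c with
  | _ n ih =>
    subst hn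
    by_contra hne
    obtain ⟨m, hm, e | e | e⟩ := h a b c ha hb hc
    · have h1 := latticeDet_midpoint (c := c) e
      have := ih _ (by omega) ha hm hc rfl
      omega
    · have h1 := latticeDet_midpoint (c := a) e
      have h2 := latticeDet_rotate a b c
      have := ih _ (by omega) hb hm ha rfl
      omega
    · have h1 := latticeDet_midpoint (c := b) e
      have h2 := latticeDet_rotate c a b
      have := ih _ (by omega) hc hm hb rfl
      omega

/-- Among three points two share a parity, so their midpoint is available for the descent. -/
theorem MidClosed.latticeDet_eq_zero_of_two_parities {T : Set (ℤ × ℤ)} (hT : MidClosed T)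
    {c₁ c₂ : ZMod 2 × ZMod 2} (hc : ∀ z ∈ T, parity z = c₁ ∨ parity z = c₂) {a b c : ℤ × ℤ}
    (ha : a ∈ T) (hb : b ∈ T) (hc' : c ∈ T) : latticeDet a b c = 0 := by
  refine latticeDet_eq_zero_of_descent (P := (· ∈ T)) ?_ ha hb hc'
  intro a b c ha hb hc'
  have : parity a = parity b ∨ parity b = parity c ∨ parity c = parity a := by
    rcases hc a ha with h1 | h1 <;> rcases hc b hb with h2 | h2 <;>
      rcases hc c hc' with h3 | h3 <;> simp [h1, h2, h3]
  rcases this with e | e | e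
  · obtain ⟨m, hm⟩ := exists_midpoint e
    exact ⟨m, hT _ ha _ hb _ hm, Or.inl hm⟩
  · obtain ⟨m, hm⟩ := exists_midpoint e
    exact ⟨m, hT _ hb _ hc' _ hm, Or.inr (Or.inl hm)⟩
  · obtain ⟨m, hm⟩ := exists_midpoint e
    exact ⟨m, hT _ hc' _ ha _ hm, Or.inr (Or.inr hm)⟩

theorem parity_midpoints {a b c m n k : ℤ × ℤ} (h₁ : a + b = m + m) (h₂ : b + c = n + n)
    (h₃ : c + a = k + k) : parity m + parity n + parity k = parity b := by
  obtain ⟨m1, m2⟩ := m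
  obtain ⟨n1, n2⟩ := n
  obtain ⟨k1, k2⟩ := k
  obtain ⟨a1, a2⟩ := a
  obtain ⟨b1, b2⟩ := b
  obtain ⟨c1, c2⟩ := c
  simp only [Prod.mk_add_mk, Prod.mk.injEq] at h₁ h₂ h₃
  simp only [parity, Prod.mk_add_mk, Prod.mk.injEq, ← Int.cast_add,
    ZMod.intCast_eq_intCast_iff, Int.ModEq]
  constructor <;> omega

/-- The parities of the three edge midpoints sum to the common parity `p` of the vertices. Three
nonzero classes with nonzero sum `p` include `p` itself, so some midpoint stays in the class and the
descent continues. -/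
theorem MidClosed.latticeDet_eq_zero_of_parity {T : Set (ℤ × ℤ)} (hT : MidClosed T)
    (h0 : ∀ z ∈ T, parity z ≠ 0) {a b c : ℤ × ℤ} (ha : a ∈ T) (hb : b ∈ T) (hc : c ∈ T)
    (hab : parity a = parity b) (hbc : parity b = parity c) : latticeDet a b c = 0 := by
  refine latticeDet_eq_zero_of_descent (P := fun z => z ∈ T ∧ parity z = parity b) ?_
    ⟨ha, hab⟩ ⟨hb, rfl⟩ ⟨hc, hbc.symm⟩
  generalize parity b = p at *
  rintro a b c ⟨ha, hpa⟩ ⟨hb, hpb⟩ ⟨hc, hpc⟩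
  obtain ⟨m, hm⟩ := exists_midpoint (hpa.trans hpb.symm)
  obtain ⟨n, hn⟩ := exists_midpoint (hpb.trans hpc.symm)
  obtain ⟨k, hk⟩ := exists_midpoint (hpc.trans hpa.symm)
  have hmT := hT _ ha _ hb _ hm
  have hnT := hT _ hb _ hc _ hn
  have hkT := hT _ hc _ ha _ hk
  rcases eq_or_eq_or_eq_of_add_add_eq (hpb ▸ h0 b hb) (h0 m hmT) (h0 n hnT) (h0 k hkT)
    ((parity_midpoints hm hn hk).trans hpb) with h | h | h
  · exact ⟨m, ⟨hmT, h⟩, Or.inl hm⟩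
  · exact ⟨n, ⟨hnT, h⟩, Or.inr (Or.inl hn)⟩
  · exact ⟨k, ⟨hkT, h⟩, Or.inr (Or.inr hk)⟩

/-- `s` lies strictly between `u` and `v`. -/
def LatticeBetween (u s v : ℤ × ℤ) : Prop :=
  ∃ a b : ℤ, 0 < a ∧ 0 < b ∧ a • (s - u) = b • (v - s)

theorem LatticeBetween.latticeDet {u s v : ℤ × ℤ} (h : LatticeBetween u s v) :
    latticeDet u v s = 0 := by
  obtain ⟨a, b, ha, hb, h⟩ := h
  obtain ⟨u1, u2⟩ := u
  obtain ⟨v1, v2⟩ := v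
  obtain ⟨s1, s2⟩ := s
  simp only [Prod.mk_sub_mk, Prod.smul_mk, Prod.mk.injEq, smul_eq_mul] at h
  obtain ⟨h1, h2⟩ := h
  simp only [_root_.latticeDet]
  apply mul_left_cancel₀ (show b ≠ 0 by omega)
  linear_combination (s1 - u1) * h2 - (s2 - u2) * h1

/-- The three open segments between three points have no common point, unless it is one of the
three points. -/
theorem eq_of_latticeBetween {u v w t : ℤ × ℤ} (h₁ : LatticeBetween u t v)
    (h₂ : LatticeBetween v t w) (h₃ : LatticeBetween w t u) : t = u := by
  obtain ⟨a, b, ha, hb, h₁⟩ := h₁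
  obtain ⟨c, d, hc, hd, h₂⟩ := h₂
  obtain ⟨e, f, he, hf, h₃⟩ := h₃
  obtain ⟨u1, u2⟩ := u
  obtain ⟨v1, v2⟩ := v
  obtain ⟨w1, w2⟩ := w
  obtain ⟨t1, t2⟩ := t
  simp only [Prod.mk_sub_mk, Prod.smul_mk, Prod.mk.injEq, smul_eq_mul] at *
  -- Chaining the three ratios around the triangle gives `(ace + bdf)(t - u) = 0`.
  have hpos : a * c * e + b * d * f ≠ 0 := by positivity
  refine ⟨sub_eq_zero.mp (mul_left_cancel₀ hpos ?_), sub_eq_zero.mp (mul_left_cancel₀ hpos ?_)⟩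
  · linear_combination c * e * h₁.1 - b * e * h₂.1 + b * d * h₃.1
  · linear_combination c * e * h₁.2 - b * e * h₂.2 + b * d * h₃.2

theorem LatticeBetween.symm {u s v : ℤ × ℤ} (h : LatticeBetween u s v) : LatticeBetween v s u := by
  obtain ⟨a, b, ha, hb, h⟩ := h
  refine ⟨b, a, hb, ha, ?_⟩
  rw [← neg_sub s u, ← neg_sub v s, smul_neg, smul_neg, h]

/-- Keep halving towards `u`; the distance shrinks, so the parity must change at some midpoint. -/
theorem MidClosed.exists_between {T : Set (ℤ × ℤ)} (hT : MidClosed T) {u v : ℤ × ℤ}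
    (hu : u ∈ T) (hv : v ∈ T) (huv : u ≠ v) (h : parity u = parity v) :
    ∃ s ∈ T, parity s ≠ parity u ∧ LatticeBetween u s v := by
  induction hn : (v.1 - u.1).natAbs + (v.2 - u.2).natAbs using Nat.strong_induction_on
    generalizing v with
  | _ n ih =>
    subst hn
    obtain ⟨m, hm⟩ := exists_midpoint h
    have hmT := hT _ hu _ hv _ hm
    by_cases hp : parity m = parity u
    · have hum : u ≠ m := by
        rintro rfl
        exact huv (add_left_cancel hm).symm
      have hlt : (m.1 - u.1).natAbs + (m.2 - u.2).natAbs <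
          (v.1 - u.1).natAbs + (v.2 - u.2).natAbs := by
        have e1 := congrArg Prod.fst hm
        have e2 := congrArg Prod.snd hm
        have hne : u.1 ≠ m.1 ∨ u.2 ≠ m.2 := by
          by_contra! hh
          exact hum (Prod.ext hh.1 hh.2)
        simp only [Prod.fst_add, Prod.snd_add] at e1 e2
        omega
      obtain ⟨s, hs, hsp, a, b, ha, hb, hab⟩ := ih _ hlt hmT hum hp.symm rfl
      refine ⟨s, hs, hsp, 2 * a + b, b, by omega, hb, ?_⟩
      have e : v = m + m - u := by rw [← hm]; abel
      have h2 : (2 * a) • (s - u) = (2 * b) • (m - s) := by rw [mul_smul, mul_smul, hab]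
      rw [e, add_smul, h2]
      module
    · refine ⟨m, hmT, hp, 1, 1, one_pos, one_pos, ?_⟩
      have e : v = m + m - u := by rw [← hm]; abel
      rw [e]; module

/-- Two pairs of points, each of constant parity, and a point of the third nonzero parity, no three
of them on a line, force a point with both coordinates even. -/
theorem MidClosed.not_two_pairs_and_point {T : Set (ℤ × ℤ)} (hT : MidClosed T)
    (h0 : ∀ z ∈ T, parity z ≠ 0) {p p' q q' r : ℤ × ℤ} (hp : p ∈ T) (hp' : p' ∈ T) (hq : q ∈ T)
    (hq' : q' ∈ T) (hr : r ∈ T) (hpp : parity p = parity p') (hqq : parity q = parity q')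
    (hpq : parity p ≠ parity q) (hrp : parity r ≠ parity p) (hrq : parity r ≠ parity q)
    (d₁ : latticeDet p p' q ≠ 0) (d₂ : latticeDet p p' q' ≠ 0) (d₃ : latticeDet p p' r ≠ 0)
    (d₄ : latticeDet q q' p ≠ 0) (d₅ : latticeDet q q' p' ≠ 0) (d₆ : latticeDet q q' r ≠ 0) :
    False := by
  have hpne : p ≠ p' := by rintro rfl; simp [latticeDet] at d₁
  have hqne : q ≠ q' := by rintro rfl; simp [latticeDet] at d₄
  have exhaust : ∀ x ∈ T, parity x = parity p ∨ parity x = parity q ∨ parity x = parity r := by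
    exact fun x hx => eq_or_eq_or_eq_of_ne_zero (h0 x hx) (h0 p hp) (h0 q hq) (h0 r hr) hpq hrp hrq
  have onp : ∀ x ∈ T, parity x = parity p → latticeDet p p' x = 0 := fun x hx h =>
    hT.latticeDet_eq_zero_of_parity h0 hp hp' hx hpp (hpp.symm.trans h.symm)
  have onq : ∀ x ∈ T, parity x = parity q → latticeDet q q' x = 0 := fun x hx h =>
    hT.latticeDet_eq_zero_of_parity h0 hq hq' hx hqq (hqq.symm.trans h.symm)
  have onr : ∀ x ∈ T, ∀ y ∈ T, ∀ z ∈ T, parity x = parity r → parity y = parity r →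
      parity z = parity r → latticeDet x y z = 0 := fun x hx y hy z hz h1 h2 h3 =>
    hT.latticeDet_eq_zero_of_parity h0 hx hy hz (h1.trans h2.symm) (h2.trans h3.symm)
  have cross : ∀ x y, latticeDet p p' x = 0 → latticeDet p p' y = 0 → latticeDet q q' x = 0 →
      latticeDet q q' y = 0 → x = y := by
    intro x y h1 h2 h3 h4
    by_contra hxy
    refine d₁ (latticeDet_eq_zero_of_line hxy ?_ ?_ ?_)
    · exact latticeDet_eq_zero_of_line hpne h1 h2 (latticeDet_self_left _ _)
    · exact latticeDet_eq_zero_of_line hpne h1 h2 (latticeDet_self_right _ _)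
    · exact latticeDet_eq_zero_of_line hqne h3 h4 (latticeDet_self_left _ _)
  -- a point of the line of one pair cannot have the parity of the other pair
  have aux : ∀ {p p' q q' : ℤ × ℤ}, q ∈ T → q' ∈ T → parity q = parity q' →
      parity r ≠ parity q →
      latticeDet p p' q ≠ 0 → latticeDet p p' q' ≠ 0 → latticeDet q q' r ≠ 0 → q ≠ q' →
      (∀ x ∈ T, parity x = parity p ∨ parity x = parity q ∨ parity x = parity r) →
      (∀ x ∈ T, parity x = parity p → latticeDet p p' x = 0) →
      (∀ x ∈ T, parity x = parity q → latticeDet q q' x = 0) →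
      (∀ x y, latticeDet p p' x = 0 → latticeDet p p' y = 0 → latticeDet q q' x = 0 →
        latticeDet q q' y = 0 → x = y) →
      ∀ s ∈ T, latticeDet p p' s = 0 → parity s ≠ parity q := by
    -- Such an `s` is where the two lines meet. Each open segment between two of `q`, `q'`, `s`
    -- contains a point of `T` of another parity. It has parity `r`, since parity `p` would force it
    -- to equal `s`.
    intro p p' q q' hq hq' hqq hrq d₁ d₂ d₆ hqne exhaust onp onq cross s hs hsp hsq
    have hsl := onq s hs hsq
    have hqs : q ≠ s := by rintro rfl; exact d₁ hsp
    have hqs' : q' ≠ s := by rintro rfl; exact d₂ hsp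
    obtain ⟨t₁, ht₁, hc₁, hb₁⟩ := hT.exists_between hq hq' hqne hqq
    obtain ⟨t₂, ht₂, hc₂, hb₂⟩ := hT.exists_between hq' hs hqs' (hqq.symm.trans hsq.symm)
    obtain ⟨t₃, ht₃, hc₃, hb₃⟩ := hT.exists_between hq hs hqs hsq.symm
    rw [← hqq] at hc₂
    have hl₁ : latticeDet q q' t₁ = 0 := hb₁.latticeDet
    have hl₂ : latticeDet q q' t₂ = 0 := latticeDet_eq_zero_of_line hqs'
      (latticeDet_eq_zero_of_line hqne (latticeDet_self_right _ _) hsl (latticeDet_self_left _ _))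
      (latticeDet_self_left _ _) hb₂.latticeDet
    have hl₃ : latticeDet q q' t₃ = 0 := latticeDet_eq_zero_of_line hqs
      (latticeDet_self_left _ _)
      (latticeDet_eq_zero_of_line hqne (latticeDet_self_left _ _) hsl (latticeDet_self_right _ _))
      hb₃.latticeDet
    have third : ∀ t ∈ T, parity t ≠ parity q → latticeDet q q' t = 0 →
        parity t = parity r := by
      intro t ht htq htl
      rcases exhaust t ht with h | h | h
      · obtain rfl := cross s t hsp (onp t ht h) hsl htl
        exact absurd hsq htq
      · exact absurd h htq
      · exact h
    -- All points of parity `r` are collinear with `r`, which is off the line `q q'`; so only one of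
    -- them lies on that line, and it would belong to all three open segments.
    have eq : ∀ t ∈ T, ∀ t' ∈ T, parity t ≠ parity q → parity t' ≠ parity q →
        latticeDet q q' t = 0 → latticeDet q q' t' = 0 → t = t' := by
      intro t ht t' ht' h1 h2 h3 h4
      by_contra hne
      refine d₆ (latticeDet_eq_zero_of_line hne ?_ ?_ ?_)
      · exact latticeDet_eq_zero_of_line hqne h3 h4 (latticeDet_self_left _ _)
      · exact latticeDet_eq_zero_of_line hqne h3 h4 (latticeDet_self_right _ _)
      · exact onr t ht t' ht' r hr (third t ht h1 h3) (third t' ht' h2 h4) rfl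
    obtain rfl := eq t₁ ht₁ t₂ ht₂ hc₁ hc₂ hl₁ hl₂
    obtain rfl := eq t₁ ht₁ t₃ ht₃ hc₁ hc₃ hl₁ hl₃
    obtain rfl := eq_of_latticeBetween hb₁ hb₂ hb₃.symm
    exact hc₁ rfl
  obtain ⟨s₁, hs₁, hc₁, hb₁⟩ := hT.exists_between hp hp' hpne hpp
  obtain ⟨s₂, hs₂, hc₂, hb₂⟩ := hT.exists_between hq hq' hqne hqq
  have hl₁ := hb₁.latticeDet
  have hl₂ := hb₂.latticeDet
  have hs₁r : parity s₁ = parity r := by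
    rcases exhaust s₁ hs₁ with h | h | h
    · exact absurd h hc₁
    · exact absurd h (aux hq hq' hqq hrq d₁ d₂ d₆ hqne exhaust onp onq cross s₁ hs₁ hl₁)
    · exact h
  have hs₂r : parity s₂ = parity r := by
    rcases exhaust s₂ hs₂ with h | h | h
    · exact absurd h (aux hp hp' hpp hrp d₄ d₅ d₃ hpne
        (fun x hx => or_left_comm.mp (exhaust x hx)) onq onp
        (fun x y h1 h2 h3 h4 => cross x y h3 h4 h1 h2) s₂ hs₂ hl₂)
    · exact absurd h hc₂
    · exact h
  have hrs₁ : r ≠ s₁ := by rintro rfl; exact d₃ hl₁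
  -- The points `r`, `s₁`, `s₂` are collinear. A point `u` of parity `p` or `q` on their line would
  -- put `r` on the line `p p'` (through `s₁`) or `q q'` (through `s₂`).
  obtain ⟨u, hu, hcu, hbu⟩ := hT.exists_between hr hs₁ hrs₁ hs₁r.symm
  have hlu := hbu.latticeDet
  rcases exhaust u hu with h | h | h
  · have hne : s₁ ≠ u := by rintro rfl; exact hcu hs₁r
    have h3 := onp u hu h
    refine d₃ (latticeDet_eq_zero_of_line hne ?_ ?_ ?_)
    · exact latticeDet_eq_zero_of_line hpne hl₁ h3 (latticeDet_self_left _ _)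
    · exact latticeDet_eq_zero_of_line hpne hl₁ h3 (latticeDet_self_right _ _)
    · rw [← latticeDet_rotate r s₁ u] at hlu; exact hlu
  · have hne : s₂ ≠ u := by rintro rfl; exact hcu hs₂r
    have h3 := onq u hu h
    refine d₆ (latticeDet_eq_zero_of_line hne ?_ ?_ ?_)
    · exact latticeDet_eq_zero_of_line hqne hl₂ h3 (latticeDet_self_left _ _)
    · exact latticeDet_eq_zero_of_line hqne hl₂ h3 (latticeDet_self_right _ _)
    · exact latticeDet_eq_zero_of_line hrs₁ (onr r hr s₁ hs₁ s₂ hs₂ rfl hs₁r hs₂r) hlu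
        (latticeDet_self_left _ _)
  · exact hcu h

/-! ### Lattice points in convex hulls -/

/-- A lattice point as a point of the Euclidean plane. -/
noncomputable def latticePoint (z : ℤ × ℤ) : EuclideanSpace ℝ (Fin 2) := !₂[(z.1 : ℝ), (z.2 : ℝ)]

theorem latticePoint_injective : Function.Injective latticePoint := by
  intro u v h
  have h0 := congrArg (fun x : EuclideanSpace ℝ (Fin 2) => x 0) h
  have h1 := congrArg (fun x : EuclideanSpace ℝ (Fin 2) => x 1) h
  simp only [latticePoint, PiLp.toLp_apply, Matrix.cons_val_zero, Matrix.cons_val_one,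
    Int.cast_inj] at h0 h1
  exact Prod.ext h0 h1

/-- The lattice points in the convex hull of a set of lattice points. -/
def latticeHull (X : Set (ℤ × ℤ)) : Set (ℤ × ℤ) :=
  {z | latticePoint z ∈ convexHull ℝ (latticePoint '' X)}

theorem mem_latticeHull {X : Set (ℤ × ℤ)} {z : ℤ × ℤ} :
    z ∈ latticeHull X ↔ latticePoint z ∈ convexHull ℝ (latticePoint '' X) := Iff.rfl

theorem subset_latticeHull (X : Set (ℤ × ℤ)) : X ⊆ latticeHull X := fun z hz =>
  mem_latticeHull.mpr (subset_convexHull ℝ _ ⟨z, hz, rfl⟩)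

theorem latticeHull_mono {X Y : Set (ℤ × ℤ)} (h : X ⊆ Y) : latticeHull X ⊆ latticeHull Y :=
  fun _ hz => mem_latticeHull.mpr (convexHull_mono (Set.image_mono h) hz)

theorem mem_latticeHull_of_mem_segment {X : Set (ℤ × ℤ)} {u v m : ℤ × ℤ} (hu : u ∈ latticeHull X)
    (hv : v ∈ latticeHull X) (hm : latticePoint m ∈ segment ℝ (latticePoint u) (latticePoint v)) :
    m ∈ latticeHull X :=
  mem_latticeHull.mpr ((convex_convexHull ℝ _).segment_subset hu hv hm)

theorem midClosed_latticeHull (X : Set (ℤ × ℤ)) : MidClosed (latticeHull X) := by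
  intro u hu v hv m h
  refine mem_latticeHull_of_mem_segment hu hv
    ⟨1 / 2, 1 / 2, by norm_num, by norm_num, by norm_num, ?_⟩
  have e1 : (u.1 : ℝ) + v.1 = m.1 + m.1 := by exact_mod_cast congrArg Prod.fst h
  have e2 : (u.2 : ℝ) + v.2 = m.2 + m.2 := by exact_mod_cast congrArg Prod.snd h
  ext i
  fin_cases i <;> simp [latticePoint] <;> linarith

theorem isLinearMap_coord (i : Fin 2) :
    IsLinearMap ℝ (fun x : EuclideanSpace ℝ (Fin 2) => x i) :=
  (EuclideanSpace.proj (𝕜 := ℝ) i).toLinearMap.isLinear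

theorem latticeHull_fst_le {X : Set (ℤ × ℤ)} {c : ℤ} (h : ∀ z ∈ X, z.1 ≤ c) {z : ℤ × ℤ}
    (hz : z ∈ latticeHull X) : z.1 ≤ c := by
  have := convexHull_min (s := latticePoint '' X) (by
    rintro _ ⟨w, hw, rfl⟩
    simpa [latticePoint] using h w hw) (convex_halfSpace_le (isLinearMap_coord 0) (c : ℝ)) hz
  simpa [latticePoint] using this

theorem latticeHull_snd_le {X : Set (ℤ × ℤ)} {c : ℤ} (h : ∀ z ∈ X, z.2 ≤ c) {z : ℤ × ℤ}
    (hz : z ∈ latticeHull X) : z.2 ≤ c := by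
  have := convexHull_min (s := latticePoint '' X) (by
    rintro _ ⟨w, hw, rfl⟩
    simpa [latticePoint] using h w hw) (convex_halfSpace_le (isLinearMap_coord 1) (c : ℝ)) hz
  simpa [latticePoint] using this

theorem le_latticeHull_fst {X : Set (ℤ × ℤ)} {c : ℤ} (h : ∀ z ∈ X, c ≤ z.1) {z : ℤ × ℤ}
    (hz : z ∈ latticeHull X) : c ≤ z.1 := by
  have := convexHull_min (s := latticePoint '' X) (by
    rintro _ ⟨w, hw, rfl⟩
    simpa [latticePoint] using h w hw) (convex_halfSpace_ge (isLinearMap_coord 0) (c : ℝ)) hz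
  simpa [latticePoint] using this

theorem le_latticeHull_snd {X : Set (ℤ × ℤ)} {c : ℤ} (h : ∀ z ∈ X, c ≤ z.2) {z : ℤ × ℤ}
    (hz : z ∈ latticeHull X) : c ≤ z.2 := by
  have := convexHull_min (s := latticePoint '' X) (by
    rintro _ ⟨w, hw, rfl⟩
    simpa [latticePoint] using h w hw) (convex_halfSpace_ge (isLinearMap_coord 1) (c : ℝ)) hz
  simpa [latticePoint] using this

theorem collinear_of_latticeDet_eq_zero {a b c : ℤ × ℤ} (h : latticeDet a b c = 0) (hab : a ≠ b) :
    Collinear ℝ {latticePoint a, latticePoint b, latticePoint c} := by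
  rw [collinear_iff_of_mem (p₀ := latticePoint a) (by simp)]
  refine ⟨latticePoint b - latticePoint a, ?_⟩
  have hd : ((b.1 : ℝ) - a.1) * (c.2 - a.2) - (b.2 - a.2) * (c.1 - a.1) = 0 := by
    exact_mod_cast h
  have hc : ∃ r : ℝ, latticePoint c = r • (latticePoint b - latticePoint a) +ᵥ latticePoint a := by
    by_cases h1 : b.1 = a.1
    · have h2 : (b.2 : ℝ) - a.2 ≠ 0 := by
        rw [sub_ne_zero]
        exact_mod_cast fun e : b.2 = a.2 => hab (Prod.ext h1.symm e.symm)
      refine ⟨(c.2 - a.2) / (b.2 - a.2), ?_⟩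
      ext i
      fin_cases i
      · simp [latticePoint]
        field_simp
        linear_combination -hd
      · simp [latticePoint]
        field_simp
        ring
    · have h2 : (b.1 : ℝ) - a.1 ≠ 0 := by
        rw [sub_ne_zero]
        exact_mod_cast h1
      refine ⟨(c.1 - a.1) / (b.1 - a.1), ?_⟩
      ext i
      fin_cases i
      · simp [latticePoint]
        field_simp
        ring
      · simp [latticePoint]
        field_simp
        linear_combination hd
  simp only [Set.mem_insert_iff, Set.mem_singleton_iff]
  rintro p (rfl | rfl | rfl)
  · exact ⟨0, by simp⟩
  · exact ⟨1, by simp⟩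
  · exact hc

/-! ### Hollow polygons -/

/-- The vertex set of a convex polygon with vertices in `A` and no other point of `A`. -/
structure IsHollow (A : Set (ℤ × ℤ)) (X : Finset (ℤ × ℤ)) : Prop where
  subset : ∀ z ∈ X, z ∈ A
  extreme : ∀ z ∈ X, z ∉ latticeHull ((X : Set (ℤ × ℤ)) \ {z})
  hollow : ∀ z ∈ A, z ∈ latticeHull X → z ∈ X

namespace IsHollow

variable {A : Set (ℤ × ℤ)} {X : Finset (ℤ × ℤ)}

/-- A vertex of `X` outside `Y` but in the hull of `Y` would lie in the hull of the other vertices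
of `X`. -/
theorem mono (h : IsHollow A X) {Y : Finset (ℤ × ℤ)} (hY : Y ⊆ X) : IsHollow A Y := by
  have hYX : (Y : Set (ℤ × ℤ)) ⊆ X := Finset.coe_subset.mpr hY
  refine ⟨fun z hz => h.subset z (hY hz), fun z hz hz' => h.extreme z (hY hz)
    (latticeHull_mono (Set.sdiff_subset_sdiff_left hYX) hz'), fun z hz hzY => ?_⟩
  by_contra hne
  have hzX := h.hollow z hz (latticeHull_mono hYX hzY)
  exact h.extreme z hzX (latticeHull_mono (Set.subset_sdiff_singleton hYX hne) hzY)

theorem midpoint_not_mem (h : IsHollow A X) {u v m : ℤ × ℤ} (hu : u ∈ X) (hv : v ∈ X)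
    (huv : u ≠ v) (hm : u + v = m + m) : m ∉ A := by
  intro hmA
  have hmX := h.hollow m hmA (midClosed_latticeHull _ u (subset_latticeHull _ hu) v
    (subset_latticeHull _ hv) m hm)
  have hu' : u ∈ (X : Set (ℤ × ℤ)) \ {m} := ⟨hu, by
    rintro rfl
    exact huv (add_left_cancel hm).symm⟩
  have hv' : v ∈ (X : Set (ℤ × ℤ)) \ {m} := ⟨hv, by
    rintro rfl
    exact huv (add_right_cancel hm)⟩
  exact h.extreme m hmX (midClosed_latticeHull _ u (subset_latticeHull _ hu') v
    (subset_latticeHull _ hv') m hm)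

theorem latticeDet_ne_zero (h : IsHollow A X) {a b c : ℤ × ℤ} (ha : a ∈ X) (hb : b ∈ X)
    (hc : c ∈ X) (hab : a ≠ b) (hac : a ≠ c) (hbc : b ≠ c) : latticeDet a b c ≠ 0 := by
  intro hd
  have key : ∀ {u m v : ℤ × ℤ}, u ∈ X → m ∈ X → v ∈ X → u ≠ m → v ≠ m →
      ¬ Wbtw ℝ (latticePoint u) (latticePoint m) (latticePoint v) := by
    intro u m v hu hm hv hum hvm hw
    have hu' : u ∈ (X : Set (ℤ × ℤ)) \ {m} := ⟨hu, hum⟩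
    have hv' : v ∈ (X : Set (ℤ × ℤ)) \ {m} := ⟨hv, hvm⟩
    exact h.extreme _ hm (mem_latticeHull_of_mem_segment (subset_latticeHull _ hu')
      (subset_latticeHull _ hv') (mem_segment_iff_wbtw.mpr hw))
  rcases (collinear_of_latticeDet_eq_zero hd hab).wbtw_or_wbtw_or_wbtw with hw | hw | hw
  · exact key ha hb hc hab hbc.symm hw
  · exact key hb hc ha hbc hac hw
  · exact key hc ha hb hac.symm hab.symm hw

theorem card_le_four_of_midpoint (h : IsHollow A X) (f : ℤ × ℤ → ZMod 2 × ZMod 2)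
    (hf : ∀ u ∈ X, ∀ v ∈ X, f u = f v → ∃ m ∈ A, u + v = m + m) : X.card ≤ 4 := by
  have := Finset.card_le_card_of_injOn (s := X) (t := Finset.univ) f (by simp) (by
    intro u hu v hv huv
    by_contra hne
    obtain ⟨m, hm, hmm⟩ := hf u hu v hv huv
    exact h.midpoint_not_mem hu hv hne hmm hm)
  simpa using this

theorem card_le_two_of_latticeDet (h : IsHollow A X)
    (hd : ∀ a ∈ X, ∀ b ∈ X, ∀ c ∈ X, latticeDet a b c = 0) : X.card ≤ 2 := by
  by_contra! hcard
  obtain ⟨a, b, c, ha, hb, hc, hab, hac, hbc⟩ := Finset.two_lt_card_iff.mp hcard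
  exact h.latticeDet_ne_zero ha hb hc hab hac hbc (hd a ha b hb c hc)

theorem card_le_two_of_two_parities (h : IsHollow A X) {c₁ c₂ : ZMod 2 × ZMod 2}
    (hc : ∀ z ∈ latticeHull X, parity z = c₁ ∨ parity z = c₂) : X.card ≤ 2 :=
  h.card_le_two_of_latticeDet fun _ ha _ hb _ hc' =>
    (midClosed_latticeHull _).latticeDet_eq_zero_of_two_parities hc (subset_latticeHull _ ha)
      (subset_latticeHull _ hb) (subset_latticeHull _ hc')

/-- Each of the three nonzero classes has at most two vertices. Five vertices would therefore fill
two classes and meet the third, which `MidClosed.not_two_pairs_and_point` excludes. -/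
theorem card_le_four_of_parity_ne_zero (h : IsHollow A X)
    (h0 : ∀ z ∈ latticeHull X, parity z ≠ 0) : X.card ≤ 4 := by
  have hT := midClosed_latticeHull (X : Set (ℤ × ℤ))
  have hsub : ∀ z ∈ X, z ∈ latticeHull (X : Set (ℤ × ℤ)) := fun z hz => subset_latticeHull _ hz
  have two : ∀ c, (X.filter (parity · = c)).card ≤ 2 := fun c =>
    (h.mono (Finset.filter_subset _ _)).card_le_two_of_latticeDet fun a ha b hb d hd => by
      simp only [Finset.mem_filter] at ha hb hd
      exact hT.latticeDet_eq_zero_of_parity h0 (hsub _ ha.1) (hsub _ hb.1) (hsub _ hd.1)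
        (ha.2.trans hb.2.symm) (hb.2.trans hd.2.symm)
  have config : ∀ c₁ c₂ c₃, c₁ ≠ c₂ → c₃ ≠ c₁ → c₃ ≠ c₂ → 1 < (X.filter (parity · = c₁)).card →
      1 < (X.filter (parity · = c₂)).card → 0 < (X.filter (parity · = c₃)).card → False := by
    intro c₁ c₂ c₃ h12 h31 h32 n1 n2 n3
    obtain ⟨p, hp, p', hp', hpp⟩ := Finset.one_lt_card.mp n1
    obtain ⟨q, hq, q', hq', hqq⟩ := Finset.one_lt_card.mp n2
    obtain ⟨r, hr⟩ := Finset.card_pos.mp n3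
    simp only [Finset.mem_filter] at hp hp' hq hq' hr
    have ne : ∀ {u v : ℤ × ℤ} {c d : ZMod 2 × ZMod 2}, parity u = c → parity v = d → c ≠ d →
        u ≠ v := by
      rintro u _ c d h1 h2 h3 rfl
      exact h3 (h1.symm.trans h2)
    refine hT.not_two_pairs_and_point h0 (hsub _ hp.1) (hsub _ hp'.1) (hsub _ hq.1)
      (hsub _ hq'.1) (hsub _ hr.1) (hp.2.trans hp'.2.symm) (hq.2.trans hq'.2.symm)
      (by rw [hp.2, hq.2]; exact h12) (by rw [hr.2, hp.2]; exact h31)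
      (by rw [hr.2, hq.2]; exact h32)
      (h.latticeDet_ne_zero hp.1 hp'.1 hq.1 hpp ?_ ?_)
      (h.latticeDet_ne_zero hp.1 hp'.1 hq'.1 hpp ?_ ?_)
      (h.latticeDet_ne_zero hp.1 hp'.1 hr.1 hpp ?_ ?_)
      (h.latticeDet_ne_zero hq.1 hq'.1 hp.1 hqq ?_ ?_)
      (h.latticeDet_ne_zero hq.1 hq'.1 hp'.1 hqq ?_ ?_)
      (h.latticeDet_ne_zero hq.1 hq'.1 hr.1 hqq ?_ ?_)
    · exact ne hp.2 hq.2 h12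
    · exact ne hp'.2 hq.2 h12
    · exact ne hp.2 hq'.2 h12
    · exact ne hp'.2 hq'.2 h12
    · exact ne hp.2 hr.2 h31.symm
    · exact ne hp'.2 hr.2 h31.symm
    · exact ne hq.2 hp.2 h12.symm
    · exact ne hq'.2 hp.2 h12.symm
    · exact ne hq.2 hp'.2 h12.symm
    · exact ne hq'.2 hp'.2 h12.symm
    · exact ne hq.2 hr.2 h32.symm
    · exact ne hq'.2 hr.2 h32.symm
  have hcover : X ⊆ X.filter (parity · = (0, 1)) ∪
      (X.filter (parity · = (1, 0)) ∪ X.filter (parity · = (1, 1))) := by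
    intro z hz
    have := eq_or_eq_or_eq_of_ne_zero (a := (0, 1)) (b := (1, 0)) (c := (1, 1))
      (h0 z (hsub z hz)) (by decide) (by decide) (by decide) (by decide) (by decide) (by decide)
    simpa [hz] using this
  have hle := (Finset.card_le_card hcover).trans ((Finset.card_union_le _ _).trans
    (Nat.add_le_add_left (Finset.card_union_le _ _) _))
  have b1 := two (0, 1)
  have b2 := two (1, 0)
  have b3 := two (1, 1)
  have c1 := config (0, 1) (1, 0) (1, 1) (by decide) (by decide) (by decide)
  have c2 := config (0, 1) (1, 1) (1, 0) (by decide) (by decide) (by decide)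
  have c3 := config (1, 0) (1, 1) (0, 1) (by decide) (by decide) (by decide)
  by_contra! hlt
  by_cases e1 : (X.filter (parity · = (0, 1))).card = 2
  · by_cases e2 : (X.filter (parity · = (1, 0))).card = 2
    · exact c1 (by omega) (by omega) (by omega)
    · exact c2 (by omega) (by omega) (by omega)
  · exact c3 (by omega) (by omega) (by omega)

end IsHollow

/-! ### Transfer to Helly numbers in the plane -/

theorem finite_convexHull_inter_planePoints (A : Set (ℤ × ℤ))
    {X : Set (EuclideanSpace ℝ (Fin 2))} (hX : X.Finite) :
    (convexHull ℝ X ∩ planePoints A).Finite := by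
  obtain ⟨R, hR⟩ := (isBounded_convexHull.mpr hX.isBounded).exists_norm_le
  refine (((Set.finite_Icc (-⌈R⌉) ⌈R⌉).prod (Set.finite_Icc (-⌈R⌉) ⌈R⌉)).image
    latticePoint).subset ?_
  rintro _ ⟨hz, z, -, rfl⟩
  have h0 := (PiLp.norm_apply_le (latticePoint z) 0).trans (hR _ hz)
  have h1 := (PiLp.norm_apply_le (latticePoint z) 1).trans (hR _ hz)
  simp only [latticePoint, PiLp.toLp_apply, Matrix.cons_val_zero, Matrix.cons_val_one,
    Real.norm_eq_abs, abs_le] at h0 h1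
  have hc := Int.le_ceil R
  have hcast : ∀ a : ℤ, -R ≤ a ∧ (a : ℝ) ≤ R → a ∈ Set.Icc (-⌈R⌉) ⌈R⌉ := fun a ha =>
    ⟨by exact_mod_cast (show (-(⌈R⌉ : ℝ)) ≤ a by linarith [ha.1]),
      by exact_mod_cast ha.2.trans hc⟩
  exact ⟨z, ⟨hcast _ h0, hcast _ h1⟩, rfl⟩

theorem hellyNumber_planePoints_le {A : Set (ℤ × ℤ)} {k : ℕ}
    (h : ∀ X : Finset (ℤ × ℤ), IsHollow A X → X.card ≤ k) :
    hellyNumber (planePoints A) ≤ k := by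
  classical
  refine iInf₂_le k (HellyProperty.of_card_hollow_le
    (fun X hX => finite_convexHull_inter_planePoints A hX) fun V hV hext hhol => ?_)
  obtain ⟨X, hXA, rfl⟩ := Finset.subset_set_image_iff.mp
    (show (V : Set _) ⊆ latticePoint '' A from hV)
  rw [Finset.card_image_of_injective _ latticePoint_injective]
  rw [Finset.coe_image] at hhol hext
  refine h X ⟨fun z hz => hXA hz, fun z hz hz' => ?_, fun z hz hz' => ?_⟩
  · refine hext _ (Finset.mem_image_of_mem _ hz) ?_
    rwa [mem_latticeHull, Set.image_sdiff latticePoint_injective, Set.image_singleton] at hz'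
  · obtain ⟨w, hw, hwz⟩ := hhol ⟨hz', z, hz, rfl⟩
    exact latticePoint_injective hwz ▸ hw

/-! ### Primes and parity classes -/

theorem two_le_of_mem_intPrimes {z : ℤ} (h : z ∈ intPrimes) : 2 ≤ z := by
  obtain ⟨p, hp, rfl⟩ := h
  exact_mod_cast hp.two_le

theorem not_mem_intPrimes_of_even {z : ℤ} (h : z % 2 = 0) (h3 : 3 ≤ z) : z ∉ intPrimes := by
  rintro ⟨p, hp, rfl⟩
  rcases hp.eq_two_or_odd with h2 | h2 <;> omega

theorem not_mem_intPrimes_of_le_one {z : ℤ} (h : z ≤ 1) : z ∉ intPrimes := fun hz => by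
  have := two_le_of_mem_intPrimes hz
  omega

theorem two_mem_intPrimes : (2 : ℤ) ∈ intPrimes := ⟨2, Nat.prime_two, rfl⟩

theorem intCast_zmod_two_eq_iff {a b : ℤ} : (a : ZMod 2) = b ↔ a % 2 = b % 2 :=
  ZMod.intCast_eq_intCast_iff a b 2

theorem parity_of_snd_odd {z : ℤ × ℤ} (h : z.2 % 2 ≠ 0) :
    parity z = (0, 1) ∨ parity z = (1, 1) := by
  have h2 : ((z.2 : ℤ) : ZMod 2) = (1 : ℤ) := intCast_zmod_two_eq_iff.mpr (by omega)
  rcases Int.emod_two_eq_zero_or_one z.1 with h1 | h1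
  · have h1 : ((z.1 : ℤ) : ZMod 2) = (0 : ℤ) := intCast_zmod_two_eq_iff.mpr (by omega)
    left; simp [parity, h1, h2]
  · have h1 : ((z.1 : ℤ) : ZMod 2) = (1 : ℤ) := intCast_zmod_two_eq_iff.mpr (by omega)
    right; simp [parity, h1, h2]

theorem parity_of_fst_odd {z : ℤ × ℤ} (h : z.1 % 2 ≠ 0) :
    parity z = (1, 0) ∨ parity z = (1, 1) := by
  have h1 : ((z.1 : ℤ) : ZMod 2) = (1 : ℤ) := intCast_zmod_two_eq_iff.mpr (by omega)
  rcases Int.emod_two_eq_zero_or_one z.2 with h2 | h2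
  · have h2 : ((z.2 : ℤ) : ZMod 2) = (0 : ℤ) := intCast_zmod_two_eq_iff.mpr (by omega)
    left; simp [parity, h1, h2]
  · have h2 : ((z.2 : ℤ) : ZMod 2) = (1 : ℤ) := intCast_zmod_two_eq_iff.mpr (by omega)
    right; simp [parity, h1, h2]

theorem parity_eq_zero_iff {z : ℤ × ℤ} : parity z = 0 ↔ z.1 % 2 = 0 ∧ z.2 % 2 = 0 := by
  have h : parity z = 0 ↔ (z.1 : ZMod 2) = (0 : ℤ) ∧ (z.2 : ZMod 2) = (0 : ℤ) := by
    simp [parity, Prod.ext_iff]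
  rw [h, intCast_zmod_two_eq_iff, intCast_zmod_two_eq_iff]
  simp

/-! ### Vertex bounds when a sublattice lies in the set -/

namespace IsHollow

variable {A : Set (ℤ × ℤ)} {X : Finset (ℤ × ℤ)}

theorem card_le_four_of_parity (h : IsHollow A X)
    (hA : ∀ u ∈ X, ∀ v ∈ X, ∀ m, u + v = m + m → m ∈ A) : X.card ≤ 4 :=
  h.card_le_four_of_midpoint parity fun u hu v hv huv => by
    obtain ⟨m, hm⟩ := exists_midpoint huv
    exact ⟨m, hA u hu v hv m hm, hm⟩

/-- The colouring is parity with respect to the sublattice `ℤ × 2ℤ`, so equally coloured points have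
their midpoint in that sublattice. -/
theorem card_le_four_of_snd_even (h : IsHollow A X) (he : ∀ z ∈ X, z.2 % 2 = 0)
    (hA : ∀ u ∈ X, ∀ v ∈ X, ∀ m, u + v = m + m → m.2 % 2 = 0 → m ∈ A) : X.card ≤ 4 :=
  h.card_le_four_of_midpoint (fun z => ((z.1 : ZMod 2), ((z.2 / 2 : ℤ) : ZMod 2)))
    fun u hu v hv huv => by
      simp only [Prod.mk.injEq, intCast_zmod_two_eq_iff] at huv
      have h1 := he u hu
      have h2 := he v hv
      have e : u + v = ((u.1 + v.1) / 2, (u.2 + v.2) / 2) + ((u.1 + v.1) / 2, (u.2 + v.2) / 2) := by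
        ext <;> simp only [Prod.fst_add, Prod.snd_add] <;> omega
      exact ⟨_, hA u hu v hv _ e (by dsimp only; omega), e⟩

theorem card_le_four_of_fst_even (h : IsHollow A X) (he : ∀ z ∈ X, z.1 % 2 = 0)
    (hA : ∀ u ∈ X, ∀ v ∈ X, ∀ m, u + v = m + m → m.1 % 2 = 0 → m ∈ A) : X.card ≤ 4 :=
  h.card_le_four_of_midpoint (fun z => (((z.1 / 2 : ℤ) : ZMod 2), (z.2 : ZMod 2)))
    fun u hu v hv huv => by
      simp only [Prod.mk.injEq, intCast_zmod_two_eq_iff] at huv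
      have h1 := he u hu
      have h2 := he v hv
      have e : u + v = ((u.1 + v.1) / 2, (u.2 + v.2) / 2) + ((u.1 + v.1) / 2, (u.2 + v.2) / 2) := by
        ext <;> simp only [Prod.fst_add, Prod.snd_add] <;> omega
      exact ⟨_, hA u hu v hv _ e (by dsimp only; omega), e⟩

theorem card_le_four_of_even (h : IsHollow A X) (he : ∀ z ∈ X, z.1 % 2 = 0 ∧ z.2 % 2 = 0)
    (hA : ∀ u ∈ X, ∀ v ∈ X, ∀ m, u + v = m + m → m.1 % 2 = 0 → m.2 % 2 = 0 → m ∈ A) :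
    X.card ≤ 4 :=
  h.card_le_four_of_midpoint (fun z => (((z.1 / 2 : ℤ) : ZMod 2), ((z.2 / 2 : ℤ) : ZMod 2)))
    fun u hu v hv huv => by
      simp only [Prod.mk.injEq, intCast_zmod_two_eq_iff] at huv
      have h1 := he u hu
      have h2 := he v hv
      have e : u + v = ((u.1 + v.1) / 2, (u.2 + v.2) / 2) + ((u.1 + v.1) / 2, (u.2 + v.2) / 2) := by
        ext <;> simp only [Prod.fst_add, Prod.snd_add] <;> omega
      exact ⟨_, hA u hu v hv _ e (by dsimp only; omega) (by dsimp only; omega), e⟩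

theorem card_le_six_of_snd (h : IsHollow A X)
    (hA : ∀ z ∈ latticeHull X, z.2 % 2 = 0 → z ∈ A) : X.card ≤ 6 := by
  have hmid := midClosed_latticeHull (X : Set (ℤ × ℤ))
  have h1 : (X.filter (fun z => z.2 % 2 = 0)).card ≤ 4 := by
    refine (h.mono (Finset.filter_subset _ _)).card_le_four_of_snd_even (by simp) ?_
    intro u hu v hv m hm he
    simp only [Finset.mem_filter] at hu hv
    exact hA m (hmid u (subset_latticeHull _ hu.1) v (subset_latticeHull _ hv.1) m hm) he
  -- A lattice point with even second coordinate in the hull of the odd vertices would lie in `A`,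
  -- hence be one of those odd vertices. So only two parities occur in that hull.
  have h2 : (X.filter (fun z => ¬ z.2 % 2 = 0)).card ≤ 2 := by
    have hY := h.mono (Finset.filter_subset (fun z => ¬ z.2 % 2 = 0) X)
    refine hY.card_le_two_of_two_parities fun z hz => parity_of_snd_odd fun he => ?_
    have := hY.hollow z (hA z (latticeHull_mono
      (Finset.coe_subset.mpr (Finset.filter_subset _ _)) hz) he) hz
    simp only [Finset.mem_filter] at this
    exact this.2 he
  rw [← Finset.card_filter_add_card_filter_not (fun z : ℤ × ℤ => z.2 % 2 = 0)]
  omega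

theorem card_le_six_of_fst (h : IsHollow A X)
    (hA : ∀ z ∈ latticeHull X, z.1 % 2 = 0 → z ∈ A) : X.card ≤ 6 := by
  have hmid := midClosed_latticeHull (X : Set (ℤ × ℤ))
  have h1 : (X.filter (fun z => z.1 % 2 = 0)).card ≤ 4 := by
    refine (h.mono (Finset.filter_subset _ _)).card_le_four_of_fst_even (by simp) ?_
    intro u hu v hv m hm he
    simp only [Finset.mem_filter] at hu hv
    exact hA m (hmid u (subset_latticeHull _ hu.1) v (subset_latticeHull _ hv.1) m hm) he
  have h2 : (X.filter (fun z => ¬ z.1 % 2 = 0)).card ≤ 2 := by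
    have hY := h.mono (Finset.filter_subset (fun z => ¬ z.1 % 2 = 0) X)
    refine hY.card_le_two_of_two_parities fun z hz => parity_of_fst_odd fun he => ?_
    have := hY.hollow z (hA z (latticeHull_mono
      (Finset.coe_subset.mpr (Finset.filter_subset _ _)) hz) he) hz
    simp only [Finset.mem_filter] at this
    exact this.2 he
  rw [← Finset.card_filter_add_card_filter_not (fun z : ℤ × ℤ => z.1 % 2 = 0)]
  omega

theorem card_le_eight (h : IsHollow A X)
    (hA : ∀ z ∈ latticeHull X, z.1 % 2 = 0 → z.2 % 2 = 0 → z ∈ A) : X.card ≤ 8 := by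
  have hmid := midClosed_latticeHull (X : Set (ℤ × ℤ))
  have h1 : (X.filter (fun z => z.1 % 2 = 0 ∧ z.2 % 2 = 0)).card ≤ 4 := by
    refine (h.mono (Finset.filter_subset _ _)).card_le_four_of_even (by simp) ?_
    intro u hu v hv m hm he
    simp only [Finset.mem_filter] at hu hv
    exact hA m (hmid u (subset_latticeHull _ hu.1) v (subset_latticeHull _ hv.1) m hm) he
  have h2 : (X.filter (fun z => ¬ (z.1 % 2 = 0 ∧ z.2 % 2 = 0))).card ≤ 4 := by
    have hY := h.mono (Finset.filter_subset (fun z => ¬ (z.1 % 2 = 0 ∧ z.2 % 2 = 0)) X)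
    refine hY.card_le_four_of_parity_ne_zero fun z hz he => ?_
    rw [parity_eq_zero_iff] at he
    have := hY.hollow z (hA z (latticeHull_mono
      (Finset.coe_subset.mpr (Finset.filter_subset _ _)) hz) he.1 he.2) hz
    rw [Finset.mem_filter] at this
    exact this.2 he
  rw [← Finset.card_filter_add_card_filter_not (fun z : ℤ × ℤ => z.1 % 2 = 0 ∧ z.2 % 2 = 0)]
  omega

end IsHollow

/-! ### Counting by regions -/

theorem card_le_of_isHollow_prod {X : Finset (ℤ × ℤ)}
    (h : IsHollow (intPrimesᶜ ×ˢ intPrimesᶜ) X) : X.card ≤ 24 := by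
  have h1 : (X.filter (fun z => z.1 ≤ 1 ∧ z.2 ≤ 1)).card ≤ 4 := by
    refine (h.mono (Finset.filter_subset _ _)).card_le_four_of_parity ?_
    intro u hu v hv m hm
    simp only [Finset.mem_filter] at hu hv
    have e1 := congrArg Prod.fst hm
    have e2 := congrArg Prod.snd hm
    simp only [Prod.fst_add, Prod.snd_add] at e1 e2
    exact ⟨not_mem_intPrimes_of_le_one (by omega), not_mem_intPrimes_of_le_one (by omega)⟩
  have h2 : (X.filter (fun z => z.1 ≤ 1 ∧ 3 ≤ z.2)).card ≤ 6 := by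
    refine (h.mono (Finset.filter_subset _ _)).card_le_six_of_snd fun z hz he => ?_
    exact ⟨not_mem_intPrimes_of_le_one (latticeHull_fst_le (by simp +contextual) hz),
      not_mem_intPrimes_of_even he (le_latticeHull_snd (by simp +contextual) hz)⟩
  have h3 : (X.filter (fun z => 3 ≤ z.1 ∧ z.2 ≤ 1)).card ≤ 6 := by
    refine (h.mono (Finset.filter_subset _ _)).card_le_six_of_fst fun z hz he => ?_
    exact ⟨not_mem_intPrimes_of_even he (le_latticeHull_fst (by simp +contextual) hz),
      not_mem_intPrimes_of_le_one (latticeHull_snd_le (by simp +contextual) hz)⟩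
  have h4 : (X.filter (fun z => 3 ≤ z.1 ∧ 3 ≤ z.2)).card ≤ 8 := by
    refine (h.mono (Finset.filter_subset _ _)).card_le_eight fun z hz he he' => ?_
    exact ⟨not_mem_intPrimes_of_even he (le_latticeHull_fst (by simp +contextual) hz),
      not_mem_intPrimes_of_even he' (le_latticeHull_snd (by simp +contextual) hz)⟩
  -- As 2 is prime, no vertex has a coordinate 2, and four quadrants suffice: `4 + 6 + 6 + 8 = 24`.
  have hcover : X ⊆ (X.filter (fun z => z.1 ≤ 1 ∧ z.2 ≤ 1) ∪
      X.filter (fun z => z.1 ≤ 1 ∧ 3 ≤ z.2)) ∪ (X.filter (fun z => 3 ≤ z.1 ∧ z.2 ≤ 1) ∪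
      X.filter (fun z => 3 ≤ z.1 ∧ 3 ≤ z.2)) := by
    intro z hz
    obtain ⟨hz1, hz2⟩ := h.subset z hz
    have n1 : z.1 ≠ 2 := fun e => hz1 (e ▸ two_mem_intPrimes)
    have n2 : z.2 ≠ 2 := fun e => hz2 (e ▸ two_mem_intPrimes)
    simp only [Finset.mem_union, Finset.mem_filter, hz, true_and]
    omega
  have := (Finset.card_le_card hcover).trans ((Finset.card_union_le _ _).trans
    (Nat.add_le_add (Finset.card_union_le _ _) (Finset.card_union_le _ _)))
  omega

theorem card_le_of_isHollow_compl {X : Finset (ℤ × ℤ)}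
    (h : IsHollow (intPrimes ×ˢ intPrimes)ᶜ X) : X.card ≤ 24 := by
  have h1 : (X.filter (fun z => z.1 ≤ 1)).card ≤ 4 := by
    refine (h.mono (Finset.filter_subset _ _)).card_le_four_of_parity ?_
    intro u hu v hv m hm hmem
    simp only [Finset.mem_filter] at hu hv
    have e1 := congrArg Prod.fst hm
    simp only [Prod.fst_add] at e1
    exact not_mem_intPrimes_of_le_one (by omega) hmem.1
  have h2 : (X.filter (fun z => z.2 ≤ 1)).card ≤ 4 := by
    refine (h.mono (Finset.filter_subset _ _)).card_le_four_of_parity ?_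
    intro u hu v hv m hm hmem
    simp only [Finset.mem_filter] at hu hv
    have e1 := congrArg Prod.snd hm
    simp only [Prod.snd_add] at e1
    exact not_mem_intPrimes_of_le_one (by omega) hmem.2
  have h3 : (X.filter (fun z => z.1 = 2)).card ≤ 2 := by
    refine (h.mono (Finset.filter_subset _ _)).card_le_two_of_latticeDet ?_
    intro a ha b hb c hc
    simp only [Finset.mem_filter] at ha hb hc
    simp [latticeDet, ha.2, hb.2, hc.2]
  have h4 : (X.filter (fun z => z.2 = 2)).card ≤ 2 := by
    refine (h.mono (Finset.filter_subset _ _)).card_le_two_of_latticeDet ?_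
    intro a ha b hb c hc
    simp only [Finset.mem_filter] at ha hb hc
    simp [latticeDet, ha.2, hb.2, hc.2]
  have h5 : (X.filter (fun z => 3 ≤ z.1 ∧ 3 ≤ z.2 ∧ z.1 % 2 = 0)).card ≤ 4 := by
    refine (h.mono (Finset.filter_subset _ _)).card_le_four_of_fst_even (by simp) ?_
    intro u hu v hv m hm he hmem
    simp only [Finset.mem_filter] at hu hv
    have e1 := congrArg Prod.fst hm
    simp only [Prod.fst_add] at e1
    exact not_mem_intPrimes_of_even he (by omega) hmem.1
  have h6 : (X.filter (fun z => 3 ≤ z.1 ∧ 3 ≤ z.2 ∧ ¬ z.1 % 2 = 0)).card ≤ 6 := by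
    refine (h.mono (Finset.filter_subset _ _)).card_le_six_of_snd fun z hz he hmem => ?_
    exact not_mem_intPrimes_of_even he (le_latticeHull_snd (by simp +contextual) hz) hmem.2
  have hcover : X ⊆ (X.filter (fun z => z.1 ≤ 1) ∪ X.filter (fun z => z.2 ≤ 1)) ∪
      ((X.filter (fun z => z.1 = 2) ∪ X.filter (fun z => z.2 = 2)) ∪
      (X.filter (fun z => 3 ≤ z.1 ∧ 3 ≤ z.2 ∧ z.1 % 2 = 0) ∪
        X.filter (fun z => 3 ≤ z.1 ∧ 3 ≤ z.2 ∧ ¬ z.1 % 2 = 0))) := by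
    intro z hz
    simp only [Finset.mem_union, Finset.mem_filter, hz, true_and]
    omega
  have := (Finset.card_le_card hcover).trans ((Finset.card_union_le _ _).trans
    (Nat.add_le_add (Finset.card_union_le _ _) ((Finset.card_union_le _ _).trans
      (Nat.add_le_add (Finset.card_union_le _ _) (Finset.card_union_le _ _)))))
  omega

theorem proposition3 :
    (hellyNumber (planePoints (intPrimesᶜ ×ˢ intPrimesᶜ)) < ⊤ ∧
      hellyNumber (planePoints ((intPrimes ×ˢ intPrimes)ᶜ)) < ⊤) ∧
    (hellyNumber (planePoints (intPrimesᶜ ×ˢ intPrimesᶜ)) ≤ 24 ∧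
      hellyNumber (planePoints ((intPrimes ×ˢ intPrimes)ᶜ)) ≤ 24) := by
  have h1 := hellyNumber_planePoints_le fun _ => card_le_of_isHollow_prod
  have h2 := hellyNumber_planePoints_le fun _ => card_le_of_isHollow_compl
  exact ⟨⟨h1.trans_lt (ENat.natCast_lt_top 24), h2.trans_lt (ENat.natCast_lt_top 24)⟩, h1, h2⟩
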